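/- Let $d\ge 1$ and write $|\cdot|$ for the maximum norm on $\mathbb R^d$ and $\mu$ for Lebesgue measure. Let $\Delta\subset[0,1]^d$ be a polytope (a bounded intersection of finitely many closed half-spaces) of dimension $d$. Let $\operatorname{diam}(\Delta)$ be its diameter for $|\cdot|$, $\operatorname{inrad}(\Delta)$ the largest $r$ such that some cubic ball $\{y:|y-c|\le r\}$ is contained in $\Delta$, $e(\Delta)$ the number of its facets, and $S(\Delta)$ its surface area, i.e. the sum over all facets $F$ of $\operatorname{vol}(F)=\mu(\{u+\lambda v_F: u\in F,\ 0\le\lambda\le 1\})$, where $v_F$ is a vector orthogonal to $F$ of Euclidean norm $1$. For $x_1,\dots,x_n\in[0,1)^d$ with $n\ge1$, the discrepancy is $$D=D(x_1,\dots,x_n)=\sup_B\left|\frac{\#\{i: x_i\in B\}}{n}-\mu(B)\right|,$$ where $B$ ranges over all boxes $\prod_{j=1}^d[a_j,b_j)$ with $0\le a_j<b_j\le1$. For a continuous $f:[0,1]^d\to E$, where $E=\mathbb R$ or, more generally, $E$ is any real Banach space with norm $|\cdot|$ (for instance $\mathbb R^d$ with the maximum norm), let $\rho(f,t)=\sup\{|f(x)-f(y)|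 : x,y\in[0,1]^d,\ |x-y|\le t\}$ for $t\ge 0$. (1) There is $\delta>0$, depending only on $\Delta$, such that for every such $E$ and $f$, every $M\in\mathbb R$ with $|f(x)|\le M$ for all $x\in[0,1)^d$, every $n\ge1$ and all $x_1,\dots,x_n\in[0,1)^d$ with discrepancy $D\le\delta$, $$\left|\frac1n\sum_{\substack{1\le i\le n\\ x_i\in\Delta}}f(x_i)-\int_\Delta f\,d\mu\right|\le(1+2^{d+1})\,\rho\big(f,D^{1/(d+1)}\big)+M\left(\frac{(1+2^{d+1})D^{1/(2d+2)}}{\operatorname{inrad}(\Delta)}+(4d\sqrt d+1)D^{1/d}e(\Delta)+\frac{2\operatorname{diam}(\Delta)S(\Delta)D^{1/(2d+2)}}{\sqrt d}\right).$$ (2) There are $C,\delta>0$, depending only on $\Delta$, such that for every such $E$ and $f$, with $M=\max\{|f(x)|:x\in[0,1]^d\}$, every $n\ge1$ and all $x_1,\dots,x_n\in[0,1)^d$ with discrepancy $D\le\delta$, $$\left|\frac1n\sum_{\substack{1\le i\le n\\ x_i\in\Delta}}f(x_i)-\int_\Delta f\,d\mu\right|\le C\left(\rho\big(f,D^{1/(d+1)}\big)+M\,D^{1/(2d+2)}\right).$$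 -/

import Mathlib

open MeasureTheory Set

noncomputable section

namespace PolytopeKoksma

/-! The space `Fin d → ℝ` carries the maximum norm, so `‖x - y‖`, `Metric.closedBall` and
`Metric.diam` below are all taken with respect to the maximum norm on `ℝ^d`. -/

/-- The half-open unit cube `[0,1)^d`. -/
def halfOpenCube (d : ℕ) : Set (Fin d → ℝ) :=
  {y | ∀ j, 0 ≤ y j ∧ y j < 1}

/-- The box `∏ [a_j, b_j)`. -/
def box {d : ℕ} (a b : Fin d → ℝ) : Set (Fin d → ℝ) :=
  {y | ∀ j, a j ≤ y j ∧ y j < b j}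

/-- The (normalized) discrepancy of the finite sequence `x_1, …, x_n`: the supremum, over all boxes
`B = ∏ [a_j, b_j)` with `0 ≤ a_j < b_j ≤ 1`, of `|#{i : x_i ∈ B} / n - μ(B)|`. -/
def discrepancy {d n : ℕ} (x : Fin n → Fin d → ℝ) : ℝ :=
  sSup {r | ∃ a b : Fin d → ℝ, (∀ j, 0 ≤ a j ∧ a j < b j ∧ b j ≤ 1) ∧
    r = |(∑ i, (box a b).indicator (fun _ => (1 : ℝ)) (x i)) / n - volume.real (box a b)|}

/-- The modulus of continuity `ρ(f, t)` of the function `f : B → E`. -/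
def modulusOfContinuity {d : ℕ} {E : Type*} [NormedAddCommGroup E] (B : Set (Fin d → ℝ))
    (f : (Fin d → ℝ) → E) (t : ℝ) : ℝ :=
  sSup {r | ∃ x ∈ B, ∃ y ∈ B, ‖x - y‖ ≤ t ∧ r = ‖f x - f y‖}

/-- A polyhedron: the intersection of finitely many closed half-spaces `{u | c ≤ ⟨v, u⟩}`. -/
def IsPolyhedron {d : ℕ} (P : Set (Fin d → ℝ)) : Prop :=
  ∃ s : Finset ((Fin d → ℝ) × ℝ), P = {u | ∀ p ∈ s, p.2 ≤ ∑ j, p.1 j * u j}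

/-- A polytope: a bounded polyhedron. -/
def IsPolytope {d : ℕ} (P : Set (Fin d → ℝ)) : Prop :=
  IsPolyhedron P ∧ Bornology.IsBounded P

/-- The dimension of (the affine hull of) a non-empty set. -/
def affineDim {d : ℕ} (C : Set (Fin d → ℝ)) : ℕ :=
  Module.finrank ℝ (vectorSpan ℝ C)

/-- A face of a convex set `C`: a convex subset `F` such that every closed segment in `C` whose
relative interior meets `F` is contained in `F`. (Since `C` and `F` are convex it is enough to speak
of the endpoints of the segment.) -/
def IsFace {d : ℕ} (C F : Set (Fin d → ℝ)) : Prop :=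
  Convex ℝ F ∧ IsExtreme ℝ C F

/-- A facet: a non-empty face of codimension one. -/
def IsFacet {d : ℕ} (C F : Set (Fin d → ℝ)) : Prop :=
  IsFace C F ∧ F.Nonempty ∧ affineDim F + 1 = affineDim C

/-- `v` is orthogonal to `F` and has Euclidean norm one. -/
def IsUnitNormal {d : ℕ} (F : Set (Fin d → ℝ)) (v : Fin d → ℝ) : Prop :=
  ∑ j, v j ^ 2 = 1 ∧ ∀ x ∈ F, ∀ y ∈ F, ∑ j, v j * (x j - y j) = 0

/-- The prism `{u + t v : u ∈ F, 0 ≤ t ≤ 1}`. -/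
def prism {d : ℕ} (F : Set (Fin d → ℝ)) (v : Fin d → ℝ) : Set (Fin d → ℝ) :=
  {w | ∃ u ∈ F, ∃ t : ℝ, 0 ≤ t ∧ t ≤ 1 ∧ w = u + t • v}

/-- The `(d-1)`-dimensional volume of a facet `F` of a `d`-dimensional polytope: the Lebesgue measure
of the prism of height one over `F`. The unit normal exists and is unique up to sign, and the sign
changes the prism only by a translation. -/
def facetVolume {d : ℕ} (F : Set (Fin d → ℝ)) : ℝ :=
  volume.real (prism F (Classical.epsilon (IsUnitNormal F)))

/-- The surface area of `P`: the sum of the volumes of its (finitely many) facets. -/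
def surfaceArea {d : ℕ} (P : Set (Fin d → ℝ)) : ℝ :=
  ∑ᶠ F ∈ {F | IsFacet P F}, facetVolume F

/-- The number of facets of `P`. -/
def numFacets {d : ℕ} (P : Set (Fin d → ℝ)) : ℕ :=
  {F | IsFacet P F}.ncard

/-- The inner radius of `P`: the largest radius of a cubic ball (a closed ball for the maximum norm)
that is contained in `P`. -/
def inrad {d : ℕ} (P : Set (Fin d → ℝ)) : ℝ :=
  sSup {r | 0 ≤ r ∧ ∃ c, Metric.closedBall c r ⊆ P}

/-- The vector `(1/n) ∑_{x_i ∈ Δ} f(x_i) - ∫_Δ f dμ`. -/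
def koksmaDifference {d n : ℕ} {E : Type*} [NormedAddCommGroup E] [NormedSpace ℝ E]
    (Δ : Set (Fin d → ℝ)) (x : Fin n → Fin d → ℝ) (f : (Fin d → ℝ) → E) : E :=
  (1 / (n : ℝ)) • (∑ i, Δ.indicator f (x i)) - ∫ y in Δ, f y

end PolytopeKoksma

end

open PolytopeKoksma

namespace PolytopeKoksma

/-! Cut the unit cube into `m ^ d` cells of side `1 / m`. On a cell inside `Δ`, replacing `f` by its
value at one point costs the modulus of continuity times (empirical mass + volume), and the constant
costs `M * D`. A cell meeting `Δ` but not contained in it costs at most `M * (D + 2 * volume)`.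
Masses and volumes each sum to at most `1`, so only the total volume of these boundary cells remains
to be bounded (`norm_koksmaDifference_le_grid`).

That bound needs only convexity: if `Δ` contains a ball of radius `r` about `c`, boundary cells lie
between the images of `Δ` under homotheties at `c` with ratios `1 ± t`, where `t * r = 1 / m`, so
their volume is `O(1 / (m * r))` (`sum_measureReal_boundary_cell_le`).

With `m` of order `D ^ (-1 / (d + 1))`, the `M`-term is at most `K * D ^ (1 / (d + 1))`, where `K`
depends on `Δ`. This is `K * ξ ^ 2` for `ξ = D ^ (1 / (2 * d + 2))`, hence at most `ξ` once `ξ ≤ 1 /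
K`. Since `inrad Δ ≤ 1`, this is stronger than both claims; the facet and surface terms enter only
through being nonnegative. -/

/-! ### Convex bodies, inner radius and homotheties. -/

lemma IsPolyhedron.convex {d : ℕ} {P : Set (Fin d → ℝ)} (hP : IsPolyhedron P) : Convex ℝ P := by
  obtain ⟨s, rfl⟩ := hP
  intro u hu v hv a b ha hb hab p hp
  have h1 := mul_le_mul_of_nonneg_left (hu p hp) ha
  have h2 := mul_le_mul_of_nonneg_left (hv p hp) hb
  have h3 : ∑ j, p.1 j * (a • u + b • v) j
      = a * ∑ j, p.1 j * u j + b * ∑ j, p.1 j * v j := by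
    rw [Finset.mul_sum, Finset.mul_sum, ← Finset.sum_add_distrib]
    refine Finset.sum_congr rfl fun j _ => ?_
    simp only [Pi.add_apply, Pi.smul_apply, smul_eq_mul]
    ring
  rw [h3]
  calc p.2 = a * p.2 + b * p.2 := by rw [← add_mul, hab, one_mul]
    _ ≤ _ := add_le_add h1 h2

lemma IsPolyhedron.isClosed {d : ℕ} {P : Set (Fin d → ℝ)} (hP : IsPolyhedron P) :
    IsClosed P := by
  obtain ⟨s, rfl⟩ := hP
  simp only [ofPred_forall]
  exact isClosed_iInter fun p => isClosed_iInter fun _ =>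
    isClosed_le continuous_const (by fun_prop)

/-- A full-dimensional convex set contains a cubic ball of positive radius. -/
lemma exists_closedBall_subset {d : ℕ} (hd : 1 ≤ d) {Δ : Set (Fin d → ℝ)} (hconv : Convex ℝ Δ)
    (hdim : affineDim Δ = d) : ∃ c, ∃ r > 0, Metric.closedBall c r ⊆ Δ := by
  have hne : Δ.Nonempty := by
    rw [nonempty_iff_ne_empty]
    rintro rfl
    rw [affineDim, vectorSpan_empty, finrank_bot] at hdim
    omega
  have htop : vectorSpan ℝ Δ = ⊤ := by
    apply Submodule.eq_top_of_finrank_eq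
    rw [Module.finrank_fin_fun]
    exact hdim
  rw [← AffineSubspace.affineSpan_eq_top_iff_vectorSpan_eq_top_of_nonempty ℝ _ _ hne,
    ← hconv.interior_nonempty_iff_affineSpan_eq_top] at htop
  obtain ⟨c, hc⟩ := htop
  obtain ⟨r, hr, h⟩ := Metric.nhds_basis_closedBall.mem_iff.1 (mem_interior_iff_mem_nhds.1 hc)
  exact ⟨c, r, hr, h⟩

lemma radius_le_one {d : ℕ} (hd : 1 ≤ d) {Δ : Set (Fin d → ℝ)} (hsub : Δ ⊆ Icc 0 1)
    {c : Fin d → ℝ} {r : ℝ} (hr : 0 ≤ r) (h : Metric.closedBall c r ⊆ Δ) : r ≤ 1 := by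
  let j : Fin d := ⟨0, hd⟩
  have mem : ∀ s : ℝ, |s| ≤ r → c + (fun _ => s) ∈ Metric.closedBall c r := by
    intro s hs
    rw [mem_closedBall_iff_norm, add_sub_cancel_left]
    exact (pi_norm_le_iff_of_nonneg hr).2 fun _ => hs
  have h1 := (hsub (h (mem r (abs_of_nonneg hr).le))).2 j
  have h2 := (hsub (h (mem 0 (by simpa using hr)))).1 j
  simp only [Pi.add_apply, Pi.zero_apply, Pi.one_apply] at h1 h2
  linarith

lemma inrad_pos_le_one {d : ℕ} (hd : 1 ≤ d) {Δ : Set (Fin d → ℝ)} (hconv : Convex ℝ Δ)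
    (hdim : affineDim Δ = d) (hsub : Δ ⊆ Icc 0 1) : 0 < inrad Δ ∧ inrad Δ ≤ 1 := by
  obtain ⟨c, r, hr, h⟩ := exists_closedBall_subset hd hconv hdim
  have hb : ∀ s ∈ {r | 0 ≤ r ∧ ∃ c, Metric.closedBall c r ⊆ Δ}, s ≤ 1 := by
    rintro s ⟨hs, c, hc⟩
    exact radius_le_one hd hsub hs hc
  have hmem : r ∈ {r | 0 ≤ r ∧ ∃ c, Metric.closedBall c r ⊆ Δ} := ⟨hr.le, c, h⟩
  exact ⟨hr.trans_le (le_csSup ⟨1, hb⟩ hmem), csSup_le ⟨r, hmem⟩ hb⟩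

lemma surfaceArea_nonneg {d : ℕ} (P : Set (Fin d → ℝ)) : 0 ≤ surfaceArea P :=
  finsum_nonneg fun _ => finsum_nonneg fun _ => measureReal_nonneg

/-- By convexity, the graph lies below its chord over `[0, 1]`. -/
lemma one_add_pow_le (d : ℕ) {t : ℝ} (h0 : 0 ≤ t) (h1 : t ≤ 1) :
    (1 + t) ^ d ≤ 1 + (2 ^ d - 1) * t := by
  induction d with
  | zero => simp
  | succ d ih =>
    have h2 : (1 : ℝ) ≤ 2 ^ d := one_le_pow₀ one_le_two
    have h3 : t * t ≤ t := mul_le_of_le_one_left h0 h1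
    calc (1 + t) ^ (d + 1) = (1 + t) ^ d * (1 + t) := pow_succ _ _
      _ ≤ (1 + (2 ^ d - 1) * t) * (1 + t) := by gcongr
      _ = 1 + 2 ^ d * t + (2 ^ d - 1) * (t * t) := by ring
      _ ≤ 1 + 2 ^ d * t + (2 ^ d - 1) * t := by gcongr
      _ = _ := by ring

lemma measureReal_image_homothety {d : ℕ} (c : Fin d → ℝ) (Δ : Set (Fin d → ℝ)) {s : ℝ}
    (hs : 0 ≤ s) :
    volume.real (AffineMap.homothety c s '' Δ) = s ^ d * volume.real Δ := by
  rw [measureReal_def, Measure.addHaar_image_homothety, ENNReal.toReal_mul,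
    ENNReal.toReal_ofReal (abs_nonneg _), Module.finrank_fin_fun, abs_of_nonneg (pow_nonneg hs d),
    measureReal_def]

lemma measureReal_le_one_of_subset {d : ℕ} {Δ : Set (Fin d → ℝ)} (hsub : Δ ⊆ Icc 0 1) :
    volume.real Δ ≤ 1 := by
  calc volume.real Δ ≤ volume.real (Icc (0 : Fin d → ℝ) 1) :=
        measureReal_mono hsub isCompact_Icc.measure_lt_top.ne
    _ = 1 := by simp [measureReal_def, Real.volume_Icc_pi]

/-- The volume of a set between the homothetic images of a convex set with ratios `1 - t` and
`1 + t`. -/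
lemma measureReal_le_of_between_homothety {d : ℕ} {Δ : Set (Fin d → ℝ)} (hconv : Convex ℝ Δ)
    (hsub : Δ ⊆ Icc 0 1) {c : Fin d → ℝ} (hc : c ∈ Δ) {t : ℝ} (h0 : 0 ≤ t) (h1 : t ≤ 1)
    {B : Set (Fin d → ℝ)} (hB : MeasurableSet B) (hout : B ⊆ AffineMap.homothety c (1 + t) '' Δ)
    (hin : Disjoint B (AffineMap.homothety c (1 - t) '' Δ)) :
    volume.real B ≤ (2 ^ d + d) * t := by
  have hmono : AffineMap.homothety c (1 - t) '' Δ ⊆ AffineMap.homothety c (1 + t) '' Δ := by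
    rintro _ ⟨w, hw, rfl⟩
    have hpos : 0 < 1 + t := by linarith
    refine ⟨AffineMap.lineMap c w ((1 - t) / (1 + t)), hconv.lineMap_mem hc hw
      ⟨div_nonneg (by linarith) hpos.le, (div_le_one hpos).2 (by linarith)⟩, ?_⟩
    ext j
    simp only [AffineMap.homothety_apply, AffineMap.lineMap_apply, vsub_eq_sub, vadd_eq_add,
      Pi.add_apply, Pi.smul_apply, Pi.sub_apply, smul_eq_mul]
    field_simp
    ring
  have hfin : volume Δ ≠ ⊤ := ((measure_mono hsub).trans_lt isCompact_Icc.measure_lt_top).ne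
  have hfin' : ∀ s : ℝ, volume (AffineMap.homothety c s '' Δ) ≠ ⊤ := fun s => by
    rw [Measure.addHaar_image_homothety]
    exact ENNReal.mul_ne_top ENNReal.ofReal_ne_top hfin
  -- `B` and the shrunken body are disjoint inside the enlarged one, so their volumes add up to at
  -- most its volume.
  have key : volume.real B + (1 - t) ^ d * volume.real Δ ≤ (1 + t) ^ d * volume.real Δ := by
    rw [← measureReal_image_homothety c Δ (by linarith : 0 ≤ 1 - t),
      ← measureReal_image_homothety c Δ (by linarith : 0 ≤ 1 + t),
      ← measureReal_union' hin hB (measure_ne_top_of_subset hout (hfin' _)) (hfin' _)]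
    exact measureReal_mono (union_subset hout hmono) (hfin' _)
  have e1 := one_add_pow_le d h0 h1
  have e2 : 1 - d * t ≤ (1 - t) ^ d := by
    have := one_add_mul_le_pow (show (-2 : ℝ) ≤ -t by linarith) d
    rw [← sub_eq_add_neg] at this
    linarith
  have e3 : (1 + t) ^ d - (1 - t) ^ d ≤ (2 ^ d + d) * t := by linarith
  have e4 : 0 ≤ (2 ^ d + (d : ℝ)) * t := by positivity
  calc volume.real B ≤ ((1 + t) ^ d - (1 - t) ^ d) * volume.real Δ := by linarith
    _ ≤ (2 ^ d + d) * t * volume.real Δ := by gcongr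
    _ ≤ (2 ^ d + d) * t * 1 := by gcongr; exact measureReal_le_one_of_subset hsub
    _ = _ := mul_one _

/-- A set of diameter at most `t r` that meets `Δ` lies in the enlarged homothetic image. -/
lemma mem_homothety_one_add {d : ℕ} {Δ : Set (Fin d → ℝ)} (hconv : Convex ℝ Δ)
    {c : Fin d → ℝ} {r : ℝ} (hball : Metric.closedBall c r ⊆ Δ) {t : ℝ} (ht : 0 < t)
    {y z : Fin d → ℝ} (hy : y ∈ Δ) (hyz : ‖z - y‖ ≤ t * r) :
    z ∈ AffineMap.homothety c (1 + t) '' Δ := by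
  -- Rescaling the small displacement `z - y` by `t⁻¹` lands in the ball. The average of `y` and
  -- this point with weights `1 : t` is the preimage of `z`.
  have hq : c + t⁻¹ • (z - y) ∈ Δ := by
    apply hball
    rw [mem_closedBall_iff_norm, add_sub_cancel_left, norm_smul, norm_inv, Real.norm_of_nonneg ht.le,
      inv_mul_le_iff₀ ht]
    exact hyz
  have hpos : 0 < 1 + t := by linarith
  refine ⟨(1 / (1 + t)) • y + (t / (1 + t)) • (c + t⁻¹ • (z - y)), hconv hy hq (by positivity)
    (by positivity) (by field_simp), ?_⟩
  ext j
  simp only [AffineMap.homothety_apply, vsub_eq_sub, vadd_eq_add,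
      Pi.add_apply, Pi.smul_apply, Pi.sub_apply, smul_eq_mul]
  field_simp
  ring

/-- If `z` is the image of `w`, then `y = (1 - t) • w + t • q` with `q = c + t⁻¹ • (y - z)` in the
ball: shrinking by `1 - t` leaves a margin of `t * r`. -/
lemma mem_of_mem_homothety_one_sub {d : ℕ} {Δ : Set (Fin d → ℝ)} (hconv : Convex ℝ Δ)
    {c : Fin d → ℝ} {r : ℝ} (hball : Metric.closedBall c r ⊆ Δ) {t : ℝ} (ht : 0 < t)
    (ht1 : t ≤ 1) {y z : Fin d → ℝ} (hz : z ∈ AffineMap.homothety c (1 - t) '' Δ)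
    (hyz : ‖y - z‖ ≤ t * r) : y ∈ Δ := by
  have hq : c + t⁻¹ • (y - z) ∈ Δ := by
    apply hball
    rw [mem_closedBall_iff_norm, add_sub_cancel_left, norm_smul, norm_inv, Real.norm_of_nonneg ht.le,
      inv_mul_le_iff₀ ht]
    exact hyz
  obtain ⟨w, hw, rfl⟩ := hz
  convert hconv hw hq (sub_nonneg.2 ht1) ht.le (sub_add_cancel 1 t) using 1
  ext j
  simp only [AffineMap.homothety_apply, vsub_eq_sub, vadd_eq_add,
      Pi.add_apply, Pi.smul_apply, Pi.sub_apply, smul_eq_mul]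
  field_simp
  ring

/-! ### Boxes, empirical mass and discrepancy. -/

lemma box_eq_pi {d : ℕ} (a b : Fin d → ℝ) : box a b = univ.pi fun j => Ico (a j) (b j) := by
  ext y
  simp [box]

lemma measurableSet_box {d : ℕ} (a b : Fin d → ℝ) : MeasurableSet (box a b) := by
  rw [box_eq_pi]
  exact MeasurableSet.univ_pi fun _ => measurableSet_Ico

lemma measureReal_box {d : ℕ} {a b : Fin d → ℝ} (h : a ≤ b) :
    volume.real (box a b) = ∏ j, (b j - a j) := by
  rw [box_eq_pi, measureReal_def, Real.volume_pi_Ico_toReal h]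

lemma halfOpenCube_eq_box (d : ℕ) : halfOpenCube d = box (0 : Fin d → ℝ) 1 := rfl

lemma halfOpenCube_subset_Icc (d : ℕ) : halfOpenCube d ⊆ Icc 0 1 :=
  fun _ hy => ⟨fun j => (hy j).1, fun j => (hy j).2.le⟩

lemma halfOpenCube_ae_eq_Icc (d : ℕ) :
    halfOpenCube d =ᵐ[volume] (Icc 0 1 : Set (Fin d → ℝ)) := by
  rw [halfOpenCube_eq_box, box_eq_pi]
  exact Measure.univ_pi_Ico_ae_eq_Icc

/-- The fraction of the points `x_1, …, x_n` that lie in `S`. -/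
noncomputable def empiricalMass {d n : ℕ} (x : Fin n → Fin d → ℝ) (S : Set (Fin d → ℝ)) : ℝ :=
  (∑ i, S.indicator (fun _ => (1 : ℝ)) (x i)) / n

lemma empiricalMass_nonneg {d n : ℕ} (x : Fin n → Fin d → ℝ) (S : Set (Fin d → ℝ)) :
    0 ≤ empiricalMass x S :=
  div_nonneg (Finset.sum_nonneg fun _ _ => indicator_nonneg (fun _ _ => zero_le_one) _)
    n.cast_nonneg

lemma empiricalMass_le_one {d n : ℕ} (x : Fin n → Fin d → ℝ) (S : Set (Fin d → ℝ)) :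
    empiricalMass x S ≤ 1 := by
  refine div_le_one_of_le₀ ?_ n.cast_nonneg
  calc (∑ i, S.indicator (fun _ => (1 : ℝ)) (x i)) ≤ ∑ _i : Fin n, (1 : ℝ) :=
        Finset.sum_le_sum fun i _ => indicator_le_self' (fun _ _ => zero_le_one) (x i)
    _ = n := by simp

lemma abs_empiricalMass_sub_le_discrepancy {d n : ℕ} (x : Fin n → Fin d → ℝ) {a b : Fin d → ℝ}
    (h : ∀ j, 0 ≤ a j ∧ a j < b j ∧ b j ≤ 1) :
    |empiricalMass x (box a b) - volume.real (box a b)| ≤ discrepancy x := by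
  refine le_csSup ⟨1, ?_⟩ ⟨a, b, h, rfl⟩
  rintro _ ⟨a, b, h, rfl⟩
  have h1 : volume.real (box a b) ≤ 1 := measureReal_le_one_of_subset fun y hy =>
    ⟨fun j => (h j).1.trans (hy j).1, fun j => (hy j).2.le.trans (h j).2.2⟩
  have h2 : 0 ≤ volume.real (box a b) := measureReal_nonneg
  have h3 := empiricalMass_nonneg x (box a b)
  have h4 := empiricalMass_le_one x (box a b)
  rw [empiricalMass] at h3 h4
  exact abs_le.2 ⟨by linarith, by linarith⟩

/-- A thin box with lower corner at a sample point has mass at least `1 / n` but volume at most `1 /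
(2 * n)`. Positivity permits dividing by powers of `D` when the mesh is chosen. -/
lemma discrepancy_pos {d n : ℕ} (hd : 1 ≤ d) (hn : 1 ≤ n) {x : Fin n → Fin d → ℝ}
    (hx : ∀ i, x i ∈ halfOpenCube d) : 0 < discrepancy x := by
  have hn' : (1 : ℝ) ≤ n := by exact_mod_cast hn
  let i₀ : Fin n := ⟨0, hn⟩
  let j₀ : Fin d := ⟨0, hd⟩
  let b : Fin d → ℝ := fun j => min (x i₀ j + 1 / (2 * n)) 1
  have hpos : (0 : ℝ) < 1 / (2 * n) := by positivity
  have hlt : ∀ j, x i₀ j < b j := fun j => lt_min (by linarith) (hx i₀ j).2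
  have hb : ∀ j, b j ≤ 1 := fun j => min_le_right _ _
  have hle := abs_empiricalMass_sub_le_discrepancy x (a := x i₀) (b := b)
    fun j => ⟨(hx i₀ j).1, hlt j, hb j⟩
  have hvol : volume.real (box (x i₀) b) ≤ 1 / (2 * n) := by
    rw [measureReal_box fun j => (hlt j).le]
    calc ∏ j, (b j - x i₀ j) ≤ ∏ j, (if j = j₀ then 1 / (2 * n) else 1 : ℝ) := by
          refine Finset.prod_le_prod (fun j _ => (sub_pos.2 (hlt j)).le) fun j _ => ?_
          split_ifs
          · linarith [min_le_left (x i₀ j + 1 / (2 * n)) 1]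
          · linarith [hb j, (hx i₀ j).1]
      _ = 1 / (2 * n) := by simp
  have hmass : 1 / (n : ℝ) ≤ empiricalMass x (box (x i₀) b) := by
    unfold empiricalMass
    gcongr
    have hmem : x i₀ ∈ box (x i₀) b := fun j => ⟨le_rfl, hlt j⟩
    calc (1 : ℝ) = (box (x i₀) b).indicator (fun _ => (1 : ℝ)) (x i₀) :=
          by rw [indicator_of_mem hmem]
      _ ≤ _ := Finset.single_le_sum
          (f := fun i => (box (x i₀) b).indicator (fun _ => (1 : ℝ)) (x i))
          (fun i _ => indicator_nonneg (fun _ _ => zero_le_one) _) (Finset.mem_univ i₀)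
  have h2 : (1 : ℝ) / n = 1 / (2 * n) + 1 / (2 * n) := by field_simp; norm_num
  have := (le_abs_self _).trans hle
  linarith

/-! ### The grid of cells. -/

/-- The cell with index `k` of the subdivision of `[0,1)^d` into `m ^ d` cubes. -/
noncomputable def cell {d m : ℕ} (k : Fin d → Fin m) : Set (Fin d → ℝ) :=
  box (fun j => (k j : ℝ) / m) (fun j => ((k j : ℝ) + 1) / m)

lemma cell_bounds {d m : ℕ} (k : Fin d → Fin m) (j : Fin d) :
    0 ≤ (k j : ℝ) / m ∧ (k j : ℝ) / m < ((k j : ℝ) + 1) / m ∧ ((k j : ℝ) + 1) / m ≤ 1 := by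
  have hm : (0 : ℝ) < m := by exact_mod_cast (k j).pos
  refine ⟨by positivity, by gcongr; linarith, (div_le_one hm).2 ?_⟩
  exact_mod_cast (k j).isLt

lemma measurableSet_cell {d m : ℕ} (k : Fin d → Fin m) : MeasurableSet (cell k) :=
  measurableSet_box _ _

lemma cell_subset {d m : ℕ} (k : Fin d → Fin m) : cell k ⊆ halfOpenCube d := fun _ hy j =>
  ⟨(cell_bounds k j).1.trans (hy j).1, (hy j).2.trans_le (cell_bounds k j).2.2⟩

lemma norm_sub_le_of_mem_cell {d m : ℕ} {k : Fin d → Fin m} {y z : Fin d → ℝ}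
    (hy : y ∈ cell k) (hz : z ∈ cell k) : ‖y - z‖ ≤ 1 / m := by
  refine (pi_norm_le_iff_of_nonneg (by positivity)).2 fun j => ?_
  have h1 := hy j
  have h2 := hz j
  simp only [add_div] at h1 h2
  rw [Pi.sub_apply, Real.norm_eq_abs, abs_le]
  constructor <;> linarith

lemma eq_of_mem_cell {d m : ℕ} {k l : Fin d → Fin m} {y : Fin d → ℝ}
    (hk : y ∈ cell k) (hl : y ∈ cell l) : k = l := by
  funext j
  have hm : (0 : ℝ) < m := by exact_mod_cast (k j).pos
  have h1 : (k j : ℝ) < l j + 1 := (div_lt_div_iff_of_pos_right hm).1 ((hk j).1.trans_lt (hl j).2)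
  have h2 : (l j : ℝ) < k j + 1 := (div_lt_div_iff_of_pos_right hm).1 ((hl j).1.trans_lt (hk j).2)
  have h1' : (k j : ℕ) < l j + 1 := by exact_mod_cast h1
  have h2' : (l j : ℕ) < k j + 1 := by exact_mod_cast h2
  exact Fin.ext (by omega)

lemma exists_mem_cell {d m : ℕ} (hm : 0 < m) {y : Fin d → ℝ} (hy : y ∈ halfOpenCube d) :
    ∃ k : Fin d → Fin m, y ∈ cell k := by
  have hm' : (0 : ℝ) < m := by exact_mod_cast hm
  have h0 : ∀ j, 0 ≤ y j * m := fun j => mul_nonneg (hy j).1 hm'.le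
  let k : Fin d → Fin m := fun j =>
    ⟨⌊y j * m⌋₊, (Nat.floor_lt (h0 j)).2 (mul_lt_of_lt_one_left hm' (hy j).2)⟩
  refine Exists.intro k fun j => And.intro ((div_le_iff₀ hm').2 (Nat.floor_le (h0 j)))
    ((lt_div_iff₀ hm').2 (Nat.lt_floor_add_one _))

lemma iUnion_cell {d m : ℕ} (hm : 0 < m) : ⋃ k : Fin d → Fin m, cell k = halfOpenCube d := by
  refine Subset.antisymm (iUnion_subset cell_subset) fun y hy => ?_
  exact mem_iUnion.2 (exists_mem_cell hm hy)

lemma pairwise_disjoint_cell {d m : ℕ} :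
    Pairwise (Function.onFun Disjoint (cell : (Fin d → Fin m) → Set (Fin d → ℝ))) :=
  fun _ _ hkl => disjoint_left.2 fun _ hk hl => hkl (eq_of_mem_cell hk hl)

lemma sum_indicator_inter_cell {d m : ℕ} (hm : 0 < m) {E : Type*} [AddCommMonoid E]
    (Δ : Set (Fin d → ℝ)) (f : (Fin d → ℝ) → E) {y : Fin d → ℝ} (hy : y ∈ halfOpenCube d) :
    ∑ k : Fin d → Fin m, (Δ ∩ cell k).indicator f y = Δ.indicator f y := by
  obtain ⟨k, hk⟩ := exists_mem_cell hm hy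
  rw [Finset.sum_eq_single k]
  · by_cases h : y ∈ Δ
    · rw [indicator_of_mem h, indicator_of_mem (mem_inter h hk)]
    · rw [indicator_of_notMem h, indicator_of_notMem fun h' => h h'.1]
  · intro l _ hl
    exact indicator_of_notMem (fun h => hl (eq_of_mem_cell h.2 hk)) _
  · simp

lemma sum_empiricalMass_cell {d m n : ℕ} (hm : 0 < m) (hn : 1 ≤ n) {x : Fin n → Fin d → ℝ}
    (hx : ∀ i, x i ∈ halfOpenCube d) :
    ∑ k : Fin d → Fin m, empiricalMass x (cell k) = 1 := by
  have hn' : (n : ℝ) ≠ 0 := by exact_mod_cast (by omega : n ≠ 0)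
  simp only [empiricalMass]
  rw [← Finset.sum_div, Finset.sum_comm, div_eq_one_iff_eq hn']
  have : ∀ i, ∑ k : Fin d → Fin m, (cell k).indicator (fun _ => (1 : ℝ)) (x i) = 1 := fun i => by
    simpa using sum_indicator_inter_cell hm univ (fun _ => (1 : ℝ)) (hx i)
  simp [this]

lemma measureReal_cell_ne_top {d m : ℕ} (k : Fin d → Fin m) : volume (cell k) ≠ ⊤ :=
  ((measure_mono ((cell_subset k).trans (halfOpenCube_subset_Icc d))).trans_lt
    isCompact_Icc.measure_lt_top).ne

lemma sum_measureReal_cell_le {d m : ℕ} :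
    ∑ k : Fin d → Fin m, volume.real (cell k) ≤ 1 := by
  rw [← measureReal_biUnion_finset (fun k _ l _ h => pairwise_disjoint_cell h)
    (fun k _ => measurableSet_cell k) (fun k _ => measureReal_cell_ne_top k)]
  exact measureReal_le_one_of_subset
    (iUnion₂_subset fun k _ => (cell_subset k).trans (halfOpenCube_subset_Icc d))

/-! ### Modulus of continuity and the error on one cell. -/

lemma norm_sub_le_modulusOfContinuity {d : ℕ} {E : Type*} [NormedAddCommGroup E]
    {f : (Fin d → ℝ) → E} (hf : ContinuousOn f (Icc 0 1)) {t : ℝ} {y z : Fin d → ℝ}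
    (hy : y ∈ Icc (0 : Fin d → ℝ) 1) (hz : z ∈ Icc (0 : Fin d → ℝ) 1) (h : ‖y - z‖ ≤ t) :
    ‖f y - f z‖ ≤ modulusOfContinuity (Icc 0 1) f t := by
  obtain ⟨K, hK⟩ := isCompact_Icc.exists_bound_of_continuousOn hf
  refine le_csSup ⟨K + K, ?_⟩ ⟨y, hy, z, hz, h, rfl⟩
  rintro _ ⟨u, hu, v, hv, -, rfl⟩
  exact (norm_sub_le _ _).trans (add_le_add (hK u hu) (hK v hv))

lemma modulusOfContinuity_nonneg {d : ℕ} {E : Type*} [NormedAddCommGroup E]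
    (B : Set (Fin d → ℝ)) (f : (Fin d → ℝ) → E) (t : ℝ) : 0 ≤ modulusOfContinuity B f t := by
  apply Real.sSup_nonneg
  rintro _ ⟨_, _, _, _, _, rfl⟩
  exact norm_nonneg _

section Banach

variable {d m n : ℕ} {E : Type*} [NormedAddCommGroup E] [NormedSpace ℝ E]

lemma norm_average_indicator_le (x : Fin n → Fin d → ℝ) {S : Set (Fin d → ℝ)}
    {g : (Fin d → ℝ) → E} {K : ℝ} (h : ∀ y ∈ S, ‖g y‖ ≤ K) :
    ‖(1 / (n : ℝ)) • ∑ i, S.indicator g (x i)‖ ≤ K * empiricalMass x S := by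
  have hsum : ‖∑ i, S.indicator g (x i)‖ ≤ K * ∑ i, S.indicator (fun _ => (1 : ℝ)) (x i) := by
    rw [Finset.mul_sum]
    refine norm_sum_le_of_le _ fun i _ => ?_
    by_cases hi : x i ∈ S
    · simpa [hi] using h _ hi
    · simp [hi]
  rw [norm_smul, Real.norm_of_nonneg (by positivity), empiricalMass, ← mul_div_assoc,
    one_div_mul_eq_div]
  gcongr

lemma norm_koksmaDifference_le (x : Fin n → Fin d → ℝ) {S : Set (Fin d → ℝ)}
    (hS : volume S < ⊤) {g : (Fin d → ℝ) → E} {K : ℝ} (h : ∀ y ∈ S, ‖g y‖ ≤ K) :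
    ‖koksmaDifference S x g‖ ≤ K * (empiricalMass x S + volume.real S) := by
  rw [mul_add]
  exact (norm_sub_le _ _).trans (add_le_add (norm_average_indicator_le x h)
    (norm_setIntegral_le_of_norm_le_const hS h))

/-- Separates the oscillation of `f`, controlled by continuity, from a constant, for which only the
discrepancy of `S` matters. -/
lemma koksmaDifference_sub_const [CompleteSpace E] (x : Fin n → Fin d → ℝ)
    {S : Set (Fin d → ℝ)} (hS : volume S ≠ ⊤) {f : (Fin d → ℝ) → E}
    (hf : IntegrableOn f S) (e : E) :
    koksmaDifference S x f = koksmaDifference S x (fun y => f y - e)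
      + (empiricalMass x S - volume.real S) • e := by
  have h1 : ∫ y in S, (f y - e) = (∫ y in S, f y) - volume.real S • e := by
    rw [integral_sub hf (integrableOn_const hS), setIntegral_const]
  have h2 : ∀ y, S.indicator f y
      = S.indicator (fun y => f y - e) y + S.indicator (fun _ => (1 : ℝ)) y • e := fun y => by
    by_cases hy : y ∈ S <;> simp [hy]
  simp only [koksmaDifference, h1, h2, empiricalMass, Finset.sum_add_distrib, ← Finset.sum_smul,
    smul_add, smul_smul, sub_smul, one_div_mul_eq_div]
  abel

lemma koksmaDifference_eq_sum_cell (hm : 0 < m) {x : Fin n → Fin d → ℝ}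
    (hx : ∀ i, x i ∈ halfOpenCube d) {Δ : Set (Fin d → ℝ)} (hΔ : MeasurableSet Δ)
    (hsub : Δ ⊆ Icc 0 1) {f : (Fin d → ℝ) → E} (hf : IntegrableOn f (Icc 0 1)) :
    koksmaDifference Δ x f = ∑ k : Fin d → Fin m, koksmaDifference (Δ ∩ cell k) x f := by
  have h1 : ∫ y in Δ, f y = ∑ k : Fin d → Fin m, ∫ y in Δ ∩ cell k, f y := by
    rw [← integral_iUnion_fintype (fun k => hΔ.inter (measurableSet_cell k))
      (fun k l h => (pairwise_disjoint_cell h).mono inter_subset_right inter_subset_right)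
      (fun k => hf.mono_set (inter_subset_left.trans hsub)), ← inter_iUnion, iUnion_cell hm]
    apply setIntegral_congr_set
    have := (ae_eq_refl Δ).inter (halfOpenCube_ae_eq_Icc d)
    rw [inter_eq_left.2 hsub] at this
    exact this.symm
  simp only [koksmaDifference, h1, Finset.sum_sub_distrib, ← Finset.smul_sum]
  rw [Finset.sum_comm]
  simp only [sum_indicator_inter_cell hm Δ f (hx _)]

/-- The estimate on one cell. -/
lemma norm_koksmaDifference_cell_le [CompleteSpace E] {x : Fin n → Fin d → ℝ}
    {Δ : Set (Fin d → ℝ)} {f : (Fin d → ℝ) → E}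
    (hf : ContinuousOn f (Icc 0 1)) {M : ℝ} (hM : ∀ y ∈ halfOpenCube d, ‖f y‖ ≤ M) {t : ℝ}
    (ht : 1 / (m : ℝ) ≤ t) (hM0 : 0 ≤ M) (hD : 0 ≤ discrepancy x) (k : Fin d → Fin m) :
    ‖koksmaDifference (Δ ∩ cell k) x f‖ ≤
      modulusOfContinuity (Icc 0 1) f t * (empiricalMass x (cell k) + volume.real (cell k))
      + M * discrepancy x
      + 2 * M * volume.real (⋃ _ : (Δ ∩ cell k).Nonempty ∧ ¬ cell k ⊆ Δ, cell k) := by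
  have hcube := (cell_subset k).trans (halfOpenCube_subset_Icc d)
  have hdisc : |empiricalMass x (cell k) - volume.real (cell k)| ≤ discrepancy x :=
    abs_empiricalMass_sub_le_discrepancy x (cell_bounds k)
  have hρ := modulusOfContinuity_nonneg (Icc 0 1) f t
  have hmass := empiricalMass_nonneg x (cell k)
  have hvol : 0 ≤ volume.real (cell k) := measureReal_nonneg
  have hM' : ∀ y ∈ cell k, ‖f y‖ ≤ M := fun y hy => hM y (cell_subset k hy)
  have hρ' := mul_nonneg hρ (add_nonneg hmass hvol)
  have hMD := mul_nonneg hM0 hD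
  have hlast : 0 ≤ 2 * M * volume.real
      (⋃ _ : (Δ ∩ cell k).Nonempty ∧ ¬ cell k ⊆ Δ, cell k) := by positivity
  by_cases hne : (Δ ∩ cell k).Nonempty
  · by_cases hin : cell k ⊆ Δ
    · obtain ⟨z, -, hz⟩ := hne
      have hS : IntegrableOn f (cell k) :=
        (hf.integrableOn_compact isCompact_Icc).mono_set hcube
      rw [inter_eq_right.2 hin, koksmaDifference_sub_const x (measureReal_cell_ne_top k) hS (f z)]
      have h1 : ‖koksmaDifference (cell k) x (fun y => f y - f z)‖ ≤ _ :=
        norm_koksmaDifference_le x (measureReal_cell_ne_top k).lt_top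
          (K := modulusOfContinuity (Icc 0 1) f t) fun y hy =>
          norm_sub_le_modulusOfContinuity hf (hcube hy) (hcube hz)
            ((norm_sub_le_of_mem_cell hy hz).trans ht)
      have h2 : ‖(empiricalMass x (cell k) - volume.real (cell k)) • f z‖ ≤ M * discrepancy x := by
        rw [norm_smul, mul_comm]
        exact mul_le_mul (hM' z hz) hdisc (norm_nonneg _) hM0
      have := norm_add_le_of_le h1 h2
      rw [inter_eq_right.2 hin] at hlast
      linarith
    -- The union over a proposition is the cell if it is a boundary cell and empty otherwise.
    · have hB : (⋃ _ : (Δ ∩ cell k).Nonempty ∧ ¬ cell k ⊆ Δ, cell k) = cell k := by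
        simp [hne, hin]
      rw [hB]
      have h1 := norm_koksmaDifference_le x (S := Δ ∩ cell k)
        ((measure_mono inter_subset_right).trans_lt (measureReal_cell_ne_top k).lt_top)
        fun y hy => hM' y hy.2
      have h2 : empiricalMass x (Δ ∩ cell k) ≤ empiricalMass x (cell k) := by
        unfold empiricalMass
        refine div_le_div_of_nonneg_right (Finset.sum_le_sum fun i _ => ?_) n.cast_nonneg
        exact indicator_le_indicator_of_subset (f := fun _ => (1 : ℝ)) inter_subset_right
          (fun _ => zero_le_one) _
      have h3 : volume.real (Δ ∩ cell k) ≤ volume.real (cell k) :=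
        measureReal_mono inter_subset_right (measureReal_cell_ne_top k)
      -- `Δ ∩ cell k` need not be a box, so discrepancy is applied to the full cell: its mass is at
      -- most `D` plus its volume.
      have h4 := (abs_le.1 hdisc).2
      have h5 : M * (empiricalMass x (Δ ∩ cell k) + volume.real (Δ ∩ cell k))
          ≤ M * (discrepancy x + 2 * volume.real (cell k)) :=
        mul_le_mul_of_nonneg_left (by linarith) hM0
      linarith
  · rw [not_nonempty_iff_eq_empty] at hne
    have : koksmaDifference (Δ ∩ cell k) x f = 0 := by simp [hne, koksmaDifference]
    rw [this, norm_zero]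
    positivity

end Banach

/-! ### Boundary cells, summation and choice of the mesh. -/

/-- The total volume of the cells that meet both a convex body and its complement. -/
lemma sum_measureReal_boundary_cell_le {d m : ℕ} (hm : 0 < m) {Δ : Set (Fin d → ℝ)}
    (hconv : Convex ℝ Δ) (hsub : Δ ⊆ Icc 0 1) {c : Fin d → ℝ} {r : ℝ} (hr : 0 < r)
    (hball : Metric.closedBall c r ⊆ Δ) (hmr : 1 / (m : ℝ) ≤ r) :
    ∑ k : Fin d → Fin m,
      volume.real (⋃ _ : (Δ ∩ cell k).Nonempty ∧ ¬ cell k ⊆ Δ, cell k) ≤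
      (2 ^ d + d) / r * (1 / m) := by
  have hm' : (0 : ℝ) < m := by exact_mod_cast hm
  -- Chosen so that the margin `t * r` equals the diameter of a cell.
  set t : ℝ := 1 / m / r with ht
  have htr : t * r = 1 / m := div_mul_cancel₀ _ hr.ne'
  have ht0 : 0 < t := by positivity
  have ht1 : t ≤ 1 := (div_le_one hr).2 hmr
  let B : (Fin d → Fin m) → Set (Fin d → ℝ) :=
    fun k => ⋃ _ : (Δ ∩ cell k).Nonempty ∧ ¬ cell k ⊆ Δ, cell k
  have hBcell : ∀ k, B k ⊆ cell k := fun k => iUnion_subset fun _ => Subset.rfl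
  have hBmeas : ∀ k, MeasurableSet (B k) := fun k =>
    MeasurableSet.iUnion fun _ => measurableSet_cell k
  have hsum : ∑ k, volume.real (B k) = volume.real (⋃ k ∈ Finset.univ, B k) :=
    (measureReal_biUnion_finset
      (fun k _ l _ h => (pairwise_disjoint_cell h).mono (hBcell k) (hBcell l))
      (fun k _ => hBmeas k)
      (fun k _ => measure_ne_top_of_subset (hBcell k) (measureReal_cell_ne_top k))).symm
  have hmem : ∀ z ∈ ⋃ k ∈ Finset.univ, B k, ∃ k : Fin d → Fin m, z ∈ cell k ∧
      (Δ ∩ cell k).Nonempty ∧ ¬ cell k ⊆ Δ := by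
    intro z hz
    simp only [B, mem_iUnion] at hz
    obtain ⟨k, -, h, hk⟩ := hz
    exact ⟨k, hk, h⟩
  change ∑ k, volume.real (B k) ≤ _
  rw [hsum, div_mul_eq_mul_div, mul_div_assoc, ← ht]
  refine measureReal_le_of_between_homothety hconv hsub
    (hball (Metric.mem_closedBall_self hr.le)) ht0.le ht1
    (Finset.measurableSet_biUnion _ fun k _ => hBmeas k) ?_ ?_
  · intro z hz
    obtain ⟨k, hk, ⟨y, hy, hyk⟩, -⟩ := hmem z hz
    exact mem_homothety_one_add hconv hball ht0 hy (htr ▸ norm_sub_le_of_mem_cell hk hyk)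
  · rw [disjoint_left]
    intro z hz hz'
    obtain ⟨k, hk, -, h⟩ := hmem z hz
    exact h fun y hy => mem_of_mem_homothety_one_sub hconv hball ht0 ht1 hz'
      (htr ▸ norm_sub_le_of_mem_cell hy hk)

/-- The estimate obtained from the subdivision of the unit cube into `m ^ d` cells. -/
lemma norm_koksmaDifference_le_grid {d m n : ℕ} {E : Type*} [NormedAddCommGroup E]
    [NormedSpace ℝ E] [CompleteSpace E] (hm : 0 < m) (hn : 1 ≤ n) {x : Fin n → Fin d → ℝ}
    (hx : ∀ i, x i ∈ halfOpenCube d) {Δ : Set (Fin d → ℝ)} (hΔ : MeasurableSet Δ)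
    (hconv : Convex ℝ Δ) (hsub : Δ ⊆ Icc 0 1) {c : Fin d → ℝ} {r : ℝ} (hr : 0 < r)
    (hball : Metric.closedBall c r ⊆ Δ) (hmr : 1 / (m : ℝ) ≤ r) {f : (Fin d → ℝ) → E}
    (hf : ContinuousOn f (Icc 0 1)) {M : ℝ} (hM : ∀ y ∈ halfOpenCube d, ‖f y‖ ≤ M) (hM0 : 0 ≤ M)
    (hD : 0 ≤ discrepancy x) {t : ℝ} (ht : 1 / (m : ℝ) ≤ t) :
    ‖koksmaDifference Δ x f‖ ≤ 2 * modulusOfContinuity (Icc 0 1) f t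
      + M * (m ^ d * discrepancy x + 2 * ((2 ^ d + d) / r) * (1 / m)) := by
  rw [koksmaDifference_eq_sum_cell hm hx hΔ hsub (hf.integrableOn_compact isCompact_Icc)]
  refine (norm_sum_le_of_le _ fun k _ =>
    norm_koksmaDifference_cell_le hf hM ht hM0 hD k).trans ?_
  rw [Finset.sum_add_distrib, Finset.sum_add_distrib, ← Finset.mul_sum, ← Finset.mul_sum,
    ← Finset.mul_sum, Finset.sum_add_distrib, sum_empiricalMass_cell hm hn hx, Finset.sum_const, Finset.card_univ,
    Fintype.card_fun, Fintype.card_fin, Fintype.card_fin, nsmul_eq_mul, Nat.cast_pow]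
  have h1 := mul_le_mul_of_nonneg_left
    (sum_measureReal_boundary_cell_le hm hconv hsub hr hball hmr) (by positivity : 0 ≤ 2 * M)
  have h2 := mul_le_mul_of_nonneg_left (sum_measureReal_cell_le (d := d) (m := m))
    (modulusOfContinuity_nonneg (Icc 0 1) f t)
  linarith

/-- For small discrepancy, the constants that depend on `Δ` are absorbed by replacing
`D ^ (1 / (d + 1))` with the larger `D ^ (1 / (2 * d + 2))`. -/
lemma exists_norm_koksmaDifference_le.{u} {d : ℕ} (hd : 1 ≤ d) {Δ : Set (Fin d → ℝ)}
    (hΔ : IsPolytope Δ) (hdim : affineDim Δ = d) (hsub : Δ ⊆ Icc 0 1) :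
    ∃ δ : ℝ, 0 < δ ∧
      ∀ (E : Type u) [NormedAddCommGroup E] [NormedSpace ℝ E] [CompleteSpace E]
        (f : (Fin d → ℝ) → E) (_ : ContinuousOn f (Icc 0 1))
        (M : ℝ) (_ : ∀ y ∈ halfOpenCube d, ‖f y‖ ≤ M)
        (n : ℕ) (_ : 1 ≤ n) (x : Fin n → Fin d → ℝ) (_ : ∀ i, x i ∈ halfOpenCube d)
        (D : ℝ) (_ : D = discrepancy x) (_ : D ≤ δ),
        0 ≤ M ∧ 0 < D ∧ ‖koksmaDifference Δ x f‖ ≤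
          2 * modulusOfContinuity (Icc 0 1) f (D ^ (1 / ((d : ℝ) + 1)))
          + M * D ^ (1 / (2 * (d : ℝ) + 2)) := by
  have hconv := hΔ.1.convex
  obtain ⟨c, r, hr, hball⟩ := exists_closedBall_subset hd hconv hdim
  -- The summand `2 ^ d` comes from `m ^ d * D` with `m ≤ 2 / η`, the other from the boundary cells.
  -- Also `1 / K ≤ r`, so a mesh below `1 / K` is fine enough for the ball.
  set K : ℝ := 2 ^ d + 2 * ((2 ^ d + d) / r) with hK
  have h2d : (1 : ℝ) ≤ 2 ^ d := one_le_pow₀ one_le_two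
  have hK1 : 1 ≤ K := h2d.trans (le_add_of_nonneg_right (by positivity))
  have hK0 : 0 < K := zero_lt_one.trans_le hK1
  have hKr : 1 / K ≤ r := by
    rw [div_le_iff₀ hK0, hK, mul_add, show r * (2 * ((2 ^ d + d) / r)) = 2 * (2 ^ d + (d : ℝ)) by
      field_simp]
    have : 0 ≤ r * 2 ^ d := by positivity
    have : (0 : ℝ) ≤ d := d.cast_nonneg
    linarith
  -- Exactly the threshold that makes `ξ ≤ 1 / K`.
  refine ⟨(1 / K) ^ (2 * d + 2), by positivity, ?_⟩
  intro E _ _ _ f hf M hM n hn x hx D hD hδ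
  have hD0 : 0 < D := hD ▸ discrepancy_pos hd hn hx
  have hM0 : 0 ≤ M := (norm_nonneg _).trans (hM (x ⟨0, hn⟩) (hx _))
  refine ⟨hM0, hD0, ?_⟩
  set ξ : ℝ := D ^ (1 / (2 * (d : ℝ) + 2)) with hξ
  set η : ℝ := D ^ (1 / ((d : ℝ) + 1)) with hη
  have hξ0 : 0 < ξ := Real.rpow_pos_of_pos hD0 _
  have hη0 : 0 < η := Real.rpow_pos_of_pos hD0 _
  have hηξ : η = ξ * ξ := by
    rw [hη, hξ, ← Real.rpow_add hD0]
    congr 1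
    field_simp
    ring
  have hηD : η ^ (d + 1) = D := by
    rw [hη, ← Real.rpow_natCast, ← Real.rpow_mul hD0.le]
    push_cast
    rw [one_div_mul_cancel (by positivity), Real.rpow_one]
  have hξK : ξ ≤ 1 / K := by
    calc ξ ≤ ((1 / K) ^ (2 * d + 2)) ^ (1 / (2 * (d : ℝ) + 2)) :=
          Real.rpow_le_rpow hD0.le hδ (by positivity)
      _ = 1 / K := by
          rw [← Real.rpow_natCast, ← Real.rpow_mul (by positivity)]
          push_cast
          rw [mul_one_div_cancel (by positivity), Real.rpow_one]
  have hξ1 : ξ ≤ 1 := hξK.trans ((div_le_one hK0).2 hK1)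
  have hηle : η ≤ ξ := hηξ ▸ mul_le_of_le_one_left hξ0.le hξ1
  have hη1 : 1 ≤ 1 / η := (one_le_div hη0).2 (hηle.trans hξ1)
  -- This balances `m ^ d * D` against `1 / m`: both become of order `η`, as `D = η ^ (d + 1)`.
  set m : ℕ := ⌈1 / η⌉₊ with hm
  have hm0 : 0 < m := Nat.ceil_pos.2 (by positivity)
  have hm0' : (0 : ℝ) < m := by exact_mod_cast hm0
  have hmη : 1 / (m : ℝ) ≤ η := (one_div_le hm0' hη0).2 (Nat.le_ceil _)
  have hm2 : (m : ℝ) ≤ 2 / η := by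
    have := Nat.ceil_lt_add_one (zero_le_one.trans hη1)
    rw [← hm] at this
    rw [show 2 / η = 1 / η + 1 / η by ring]
    linarith
  have hgrid := norm_koksmaDifference_le_grid hm0 hn hx hΔ.1.isClosed.measurableSet hconv hsub hr
    hball (hmη.trans (hηle.trans (hξK.trans hKr))) hf hM hM0 (hD ▸ hD0.le) hmη
  refine hgrid.trans ?_
  gcongr
  calc m ^ d * discrepancy x + 2 * ((2 ^ d + d) / r) * (1 / m)
      ≤ (2 / η) ^ d * η ^ (d + 1) + 2 * ((2 ^ d + d) / r) * η := by
        rw [← hD, hηD]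
        gcongr
    _ = K * ξ * ξ := by
        rw [div_pow, pow_succ, div_mul_eq_mul_div, ← mul_assoc, mul_right_comm,
          mul_div_assoc, div_self (pow_pos hη0 d).ne', mul_assoc K, ← hηξ, hK]
        ring
    -- One factor `ξ` of `η = ξ * ξ` is spent on absorbing `K`.
    _ ≤ 1 * ξ := by
        gcongr
        rw [mul_comm]
        exact (le_div_iff₀ hK0).1 hξK
    _ = ξ := one_mul ξ

end PolytopeKoksma

theorem mainTheorem3 (d : ℕ) (hd : 1 ≤ d) (Δ : Set (Fin d → ℝ)) (hΔ : IsPolytope Δ)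
    (hdim : affineDim Δ = d) (hsub : Δ ⊆ Set.Icc 0 1) :
    (∃ δ : ℝ, 0 < δ ∧
      ∀ (E : Type*) [NormedAddCommGroup E] [NormedSpace ℝ E] [CompleteSpace E]
        (f : (Fin d → ℝ) → E) (_ : ContinuousOn f (Set.Icc 0 1))
        (M : ℝ) (_ : ∀ y ∈ halfOpenCube d, ‖f y‖ ≤ M)
        (n : ℕ) (_ : 1 ≤ n) (x : Fin n → Fin d → ℝ) (_ : ∀ i, x i ∈ halfOpenCube d)
        (D : ℝ) (_ : D = discrepancy x) (_ : D ≤ δ),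
        ‖koksmaDifference Δ x f‖ ≤
          (1 + 2 ^ (d + 1)) * modulusOfContinuity (Set.Icc 0 1) f (D ^ (1 / ((d : ℝ) + 1)))
          + M * ((1 + 2 ^ (d + 1)) * D ^ (1 / (2 * (d : ℝ) + 2)) / inrad Δ
            + (4 * d * Real.sqrt d + 1) * D ^ (1 / (d : ℝ)) * numFacets Δ
            + 2 * Metric.diam Δ * surfaceArea Δ * D ^ (1 / (2 * (d : ℝ) + 2)) / Real.sqrt d)) ∧
    (∃ C δ : ℝ, 0 < C ∧ 0 < δ ∧
      ∀ (E : Type*) [NormedAddCommGroup E] [NormedSpace ℝ E] [CompleteSpace E]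
        (f : (Fin d → ℝ) → E) (_ : ContinuousOn f (Set.Icc 0 1))
        (M : ℝ) (_ : IsGreatest ((fun y => ‖f y‖) '' Set.Icc 0 1) M)
        (n : ℕ) (_ : 1 ≤ n) (x : Fin n → Fin d → ℝ) (_ : ∀ i, x i ∈ halfOpenCube d)
        (D : ℝ) (_ : D = discrepancy x) (_ : D ≤ δ),
        ‖koksmaDifference Δ x f‖ ≤
          C * (modulusOfContinuity (Set.Icc 0 1) f (D ^ (1 / ((d : ℝ) + 1)))
            + M * D ^ (1 / (2 * (d : ℝ) + 2)))) := by
  have hC : (2 : ℝ) ≤ 1 + 2 ^ (d + 1) := by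
    have : (1 : ℝ) ≤ 2 ^ (d + 1) := one_le_pow₀ one_le_two
    linarith
  constructor
  · obtain ⟨δ, hδ, h⟩ := exists_norm_koksmaDifference_le hd hΔ hdim hsub
    refine ⟨δ, hδ, ?_⟩
    intro E _ _ _ f hf M hM n hn x hx D hD hDδ
    obtain ⟨hM0, hD0, hle⟩ := h E f hf M hM n hn x hx D hD hDδ
    obtain ⟨hr0, hr1⟩ := inrad_pos_le_one hd hΔ.1.convex hdim hsub
    have hS := surfaceArea_nonneg Δ
    have hdiam : 0 ≤ Metric.diam Δ := Metric.diam_nonneg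
    have hξ := Real.rpow_nonneg hD0.le (1 / (2 * (d : ℝ) + 2))
    have hρ := modulusOfContinuity_nonneg (Icc 0 1) f (D ^ (1 / ((d : ℝ) + 1)))
    refine hle.trans (add_le_add (mul_le_mul_of_nonneg_right hC hρ)
      (mul_le_mul_of_nonneg_left ?_ hM0))
    -- The inner-radius term alone dominates `ξ`, since `inrad Δ ≤ 1`; the other two terms are
    -- dropped as nonnegative.
    rw [add_assoc]
    refine le_add_of_le_of_nonneg ?_ (by positivity)
    rw [le_div_iff₀ hr0]
    calc D ^ (1 / (2 * (d : ℝ) + 2)) * inrad Δ ≤ D ^ (1 / (2 * (d : ℝ) + 2)) :=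
          mul_le_of_le_one_right hξ hr1
      _ ≤ _ := le_mul_of_one_le_left hξ (one_le_two.trans hC)
  · obtain ⟨δ, hδ, h⟩ := exists_norm_koksmaDifference_le hd hΔ hdim hsub
    refine ⟨2, δ, two_pos, hδ, ?_⟩
    intro E _ _ _ f hf M hM n hn x hx D hD hDδ
    obtain ⟨hM0, hD0, hle⟩ := h E f hf M
      (fun y hy => hM.2 (mem_image_of_mem _ (halfOpenCube_subset_Icc d hy))) n hn x hx D hD hDδ
    have := mul_nonneg hM0 (Real.rpow_nonneg hD0.le (1 / (2 * (d : ℝ) + 2)))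
    linarith
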